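/- Let $d\ge 1$. Let $\Omega_d^+$ be the cone of positive positive definite functions on $\mathbb{R}^d$, that is, of all continuous radial functions $f:\mathbb{R}^d\to[0,\infty)$ that are positive definite: $\sum_{j,k=1}^n c_j\overline{c_k}f(x_j-x_k)\ge 0$ for all $n$, all $x_1,\dots,x_n\in\mathbb{R}^d$ and all $c_1,\dots,c_n\in\mathbb{C}$. For $f\in\Omega_d^+$ put $I(f)=\Omega_d^+\cap(f-\Omega_d^+)$; $f$ is called an extremal ray generator if $I(f)=\{t f: 0\le t\le 1\}$. Let $g:[0,\infty)\to[0,\infty)$ be completely monotonic, i.e. infinitely differentiable on $(0,\infty)$ with $(-1)^k g^{(k)}(x)\ge 0$ for all integers $k\ge 0$ and all $x>0$, and let $g$ be continuous at $0$ (from the right). Define $f(x)=g(|x|^2)$ for $x\in\mathbb{R}^d$, where $|\cdot|$ is the Euclidean norm. Then $f\in\Omega_d^+$, and $f$ is an extremal ray generator if and only if $f$ is a (possibly degenerate) Gaussian, i.e. there are $c\ge 0$ and $a\ge 0$ with $f(x)=c\,e^{-a|x|^2}$ for all $x\in\mathbb{R}^d$. In particular, if $f$ is not constant, then $f$ is an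 extremal ray generator if and only if $f(x)=c\,e^{-a|x|^2}$ for all $x\in\mathbb{R}^d$ with some $c>0$ and $a>0$. -/

import Mathlib

open scoped ContDiff ComplexOrder

/-- `F : ℝᵈ → ℂ` satisfies `∑ⱼₖ cⱼ c̄ₖ F(xⱼ - xₖ) ≥ 0` for all finite families of points and complex
coefficients. (The order on `ℂ` makes this say that the sum is real and non-negative.)
Continuity is required separately, in `posPosDefCone`. -/
def IsPosDefFun {d : ℕ} (F : EuclideanSpace ℝ (Fin d) → ℂ) : Prop :=
  ∀ (n : ℕ) (x : Fin n → EuclideanSpace ℝ (Fin d)) (c : Fin n → ℂ),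
    0 ≤ ∑ j, ∑ k, c j * starRingEnd ℂ (c k) * F (x j - x k)

/-- `f` is radial: its value at `x` depends on the Euclidean norm `|x|` only. -/
def IsRadialFun {d : ℕ} (f : EuclideanSpace ℝ (Fin d) → ℝ) : Prop :=
  ∃ f₀ : ℝ → ℝ, ∀ x, f x = f₀ ‖x‖

/-- The cone of positive positive definite functions on `ℝᵈ`: continuous, radial,
positive definite and pointwise non-negative. -/
def posPosDefCone (d : ℕ) : Set (EuclideanSpace ℝ (Fin d) → ℝ) :=
  {f | Continuous f ∧ IsRadialFun f ∧ IsPosDefFun (fun x => (f x : ℂ)) ∧ ∀ x, 0 ≤ f x}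

/-- The interval `I(f) = Ω ∩ (f - Ω)` generated by `f` in a cone `Ω`. -/
def coneInterval {V : Type*} [AddCommGroup V] (Ω : Set V) (f : V) : Set V :=
  {u | u ∈ Ω ∧ ∃ v ∈ Ω, u = f - v}

/-- `f` is an extremal ray generator of `Ω`: it lies in `Ω` and
`I(f) = {t f : 0 ≤ t ≤ 1}`. -/
def IsExtremalRayGenerator {V : Type*} [AddCommGroup V] [Module ℝ V] (Ω : Set V) (f : V) : Prop :=
  f ∈ Ω ∧ coneInterval Ω f = {u | ∃ t : ℝ, 0 ≤ t ∧ t ≤ 1 ∧ u = t • f}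

/-- `g` is non-negative on `[0,∞)` and completely monotonic: smooth on `(0,∞)` with
`(-1)ᵏ g⁽ᵏ⁾ ≥ 0` there for all `k`. Values at negative arguments are irrelevant. -/
def IsCompletelyMonotonic (g : ℝ → ℝ) : Prop :=
  (∀ x, 0 ≤ x → 0 ≤ g x) ∧ ContDiffOn ℝ ∞ g (Set.Ioi 0) ∧
    ∀ (k : ℕ) (x : ℝ), 0 < x → 0 ≤ (-1) ^ k * iteratedDeriv k g x

/-! Membership of `f` in the cone comes from Taylor expansion. The shift `g (· + ε)`, expanded in
powers of `M - y`, equals `∑ A_k (1 - y/M)^k` with `A_k ≥ 0` and `∑ A_k = g ε`. As `M → ∞` each `(1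
- y/M)^k` may be replaced by `exp (-k y/M)`, with an error uniform in `k`. With `y = ‖x‖²` this
makes `f` a limit of positive combinations of Gaussians, and no representing measure is needed.

Extremal implies Gaussian: for `δ > 0` both `g (· + δ)` and `g - g (· + δ)` are completely
monotonic, so the translate gives an element of `I(f)` and is a multiple of `g`. Only exponentials
have this property (`IsCompletelyMonotonic.eq_exp_of_translates`).

Gaussian implies extremal: restrict a splitting `u + v` to a line, scaled so that the sum is `c exp
(-π x²)`. The transforms of `u` and `v` are non-negative and add up to `c exp (-π ξ²)`. Hence `u`
and its transform are both dominated by the self-dual Gaussian, the critical case of Hardy's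
uncertainty principle, which makes `u` a multiple of it (`eq_gaussian_of_spectral_bound`). Radiality
carries this back from the line to the whole space. -/

/-- Positive definite complex functions on an additive group. -/
def PosDefFunction {E : Type*} [AddGroup E] (F : E → ℂ) : Prop :=
  ∀ (n : ℕ) (x : Fin n → E) (c : Fin n → ℂ),
    0 ≤ ∑ j, ∑ k, c j * starRingEnd ℂ (c k) * F (x j - x k)

/-! ### Closure properties of positive definite functions. -/

namespace PosDefFunction

variable {E : Type*} [AddGroup E] {F G : E → ℂ}

theorem of_tendsto {ι : Type*} {l : Filter ι} [l.NeBot] {Φ : ι → E → ℂ}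
    (hΦ : ∀ᶠ i in l, PosDefFunction (Φ i)) (h : ∀ x, Filter.Tendsto (fun i => Φ i x) l (nhds (F x))) :
    PosDefFunction F := by
  intro n x c
  refine ge_of_tendsto (tendsto_finsetSum _ fun j _ => tendsto_finsetSum _ fun k _ =>
    (h (x j - x k)).const_mul _) ?_
  filter_upwards [hΦ] with i hi using hi n x c

theorem zero : PosDefFunction (fun _ : E => (0 : ℂ)) := by
  intro n x c
  simp

theorem add (hF : PosDefFunction F) (hG : PosDefFunction G) :
    PosDefFunction (fun x => F x + G x) := by
  intro n x c
  simpa only [mul_add, Finset.sum_add_distrib] using add_nonneg (hF n x c) (hG n x c)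

theorem const_mul (hF : PosDefFunction F) {r : ℝ} (hr : 0 ≤ r) :
    PosDefFunction (fun x => (r : ℂ) * F x) := by
  intro n x c
  have := mul_nonneg (Complex.zero_le_real.2 hr) (hF n x c)
  simp only [Finset.mul_sum] at this
  convert this using 1
  exact Finset.sum_congr rfl fun j _ => Finset.sum_congr rfl fun k _ => by ring

theorem sum {ι : Type*} (s : Finset ι) {Φ : ι → E → ℂ} (h : ∀ i ∈ s, PosDefFunction (Φ i)) :
    PosDefFunction (fun x => ∑ i ∈ s, Φ i x) := by
  classical
  induction s using Finset.induction_on with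
  | empty => simpa using zero
  | insert a s ha ih =>
    simp only [Finset.sum_insert ha]
    exact (h a (by simp)).add (ih fun i hi => h i (by simp [hi]))

theorem comp_hom {E' : Type*} [AddGroup E'] (hF : PosDefFunction F) (L : E' →+ E) :
    PosDefFunction (fun x => F (L x)) := by
  intro n x c
  simpa only [map_sub] using hF n (fun i => L (x i)) c

/-- Multiplication by a unitary character preserves positive definiteness. -/
theorem character_mul (hF : PosDefFunction F) {χ : E → ℂ}
    (hχ : ∀ x y, χ (x - y) = χ x * starRingEnd ℂ (χ y)) :
    PosDefFunction (fun x => χ x * F x) := by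
  intro n x c
  convert hF n x (fun j => c j * χ (x j)) using 1
  refine Finset.sum_congr rfl fun j _ => Finset.sum_congr rfl fun k _ => ?_
  simp only [hχ, map_mul]
  ring

theorem ofReal_le_zero {u : E → ℝ} (hu : PosDefFunction (fun x => (u x : ℂ)))
    (he : ∀ x, u (-x) = u x) (x : E) : u x ≤ u 0 := by
  have := hu 2 ![x, 0] ![1, -1]
  simp only [Fin.sum_univ_two] at this
  simp [he] at this
  norm_cast at this
  linarith

end PosDefFunction

/-! ### Characteristic functions and Gaussians. -/

theorem posDefFunction_charFun {E : Type*} [NormedAddCommGroup E] [InnerProductSpace ℝ E]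
    [MeasurableSpace E] [BorelSpace E] [SecondCountableTopology E]
    (μ : MeasureTheory.Measure E) [MeasureTheory.IsFiniteMeasure μ] :
    PosDefFunction (MeasureTheory.charFun μ) := by
  intro n x c
  have hint : ∀ t : E, MeasureTheory.Integrable
      (fun y : E => Complex.exp (inner ℝ y t * Complex.I)) μ := fun t => by
    refine (MeasureTheory.integrable_const (1 : ℝ)).mono' (by fun_prop) ?_
    simp [Complex.norm_exp_ofReal_mul_I]
  have key : ∑ j, ∑ k, c j * starRingEnd ℂ (c k) * MeasureTheory.charFun μ (x j - x k) =
      ∫ y, ((‖∑ j, c j * Complex.exp (inner ℝ y (x j) * Complex.I)‖ ^ 2 : ℝ) : ℂ) ∂μ := by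
    simp only [MeasureTheory.charFun_apply]
    calc _ = ∑ j, ∫ y, ∑ k, c j * starRingEnd ℂ (c k) *
          Complex.exp (inner ℝ y (x j - x k) * Complex.I) ∂μ := by
          refine Finset.sum_congr rfl fun j _ => ?_
          rw [MeasureTheory.integral_finsetSum _ fun k _ => (hint _).const_mul _]
          simp only [MeasureTheory.integral_const_mul]
      _ = ∫ y, ∑ j, ∑ k, c j * starRingEnd ℂ (c k) *
          Complex.exp (inner ℝ y (x j - x k) * Complex.I) ∂μ := by
          rw [MeasureTheory.integral_finsetSum _ fun j _ =>
            MeasureTheory.integrable_finsetSum _ fun k _ => (hint _).const_mul _]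
      _ = _ := ?_
    · refine MeasureTheory.integral_congr_ae (Filter.Eventually.of_forall fun y => ?_)
      simp only
      rw [Complex.ofReal_pow, ← Complex.mul_conj', map_sum, Finset.sum_mul_sum]
      refine Finset.sum_congr rfl fun j _ => Finset.sum_congr rfl fun k _ => ?_
      rw [map_mul, ← Complex.exp_conj, map_mul, Complex.conj_I, Complex.conj_ofReal, inner_sub_right]
      push_cast
      rw [sub_mul, sub_eq_add_neg, Complex.exp_add, mul_neg]
      ring
  rw [key, integral_complex_ofReal]
  exact_mod_cast MeasureTheory.integral_nonneg fun y => by positivity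

theorem posDefFunction_gaussian {E : Type*} [NormedAddCommGroup E] [InnerProductSpace ℝ E]
    [FiniteDimensional ℝ E] {a : ℝ} (ha : 0 ≤ a) :
    PosDefFunction (fun x : E => (Real.exp (-a * ‖x‖ ^ 2) : ℂ)) := by
  let _ : MeasurableSpace E := borel E
  have : BorelSpace E := ⟨rfl⟩
  have := (posDefFunction_charFun (ProbabilityTheory.stdGaussian E)).comp_hom
    (Real.sqrt (2 * a) • LinearMap.id : E →ₗ[ℝ] E).toAddMonoidHom
  convert this using 2 with x
  have h : ‖(Real.sqrt (2 * a) • x)‖ ^ 2 = 2 * a * ‖x‖ ^ 2 := by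
    rw [norm_smul, mul_pow, Real.norm_eq_abs, sq_abs, Real.sq_sqrt (by positivity)]
  change _ = MeasureTheory.charFun _ (Real.sqrt (2 * a) • x)
  rw [ProbabilityTheory.charFun_stdGaussian]
  norm_cast
  rw [h]
  congr 1
  ring

/-! ### Completely monotonic functions as limits of exponential sums. -/

section CompletelyMonotone

open Set Filter Topology

variable {h : ℝ → ℝ}

/-- The Taylor coefficients at `N`, in powers of `N - x`. -/
noncomputable def taylorCoeffLeft (h : ℝ → ℝ) (N : ℝ) (k : ℕ) : ℝ :=
  (-1) ^ k * iteratedDeriv k h N / k.factorial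

theorem taylorWithinEval_eq_sum_taylorCoeffLeft (hc : ContDiffOn ℝ ∞ h (Ioi 0)) {N x : ℝ}
    (hx : 0 < x) (hxN : x < N) (n : ℕ) :
    taylorWithinEval h n (uIcc N x) N x =
      ∑ k ∈ Finset.range (n + 1), taylorCoeffLeft h N k * (N - x) ^ k := by
  rw [taylor_within_apply]
  refine Finset.sum_congr rfl fun k _ => ?_
  rw [iteratedDerivWithin_eq_iteratedDeriv (uniqueDiffOn_uIcc hxN.ne')
    ((hc.contDiffAt (Ioi_mem_nhds (hx.trans hxN))).of_le (by exact_mod_cast le_top)) left_mem_uIcc,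
    taylorCoeffLeft, ← neg_sub x N, neg_pow (x - N), smul_eq_mul]
  have : ((-1 : ℝ) ^ k) * (-1) ^ k = 1 := by rw [← mul_pow]; simp
  linear_combination (-(iteratedDeriv k h N / k.factorial * (x - N) ^ k)) * this

theorem contDiffOn_uIcc_of_Ioi (hc : ContDiffOn ℝ ∞ h (Ioi 0)) {N x : ℝ}
    (hx : 0 < x) (hxN : x < N) (n : ℕ) : ContDiffOn ℝ n h (uIcc N x) := by
  refine (hc.mono ?_).of_le (by exact_mod_cast le_top)
  rw [uIcc_of_ge hxN.le]
  exact fun y hy => hx.trans_le hy.1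

/-- In the Lagrange remainder the derivative and `(x - N) ^ (n + 1)` both carry the sign `(-1) ^ (n
+ 1)`, so the remainder is non-negative. -/
theorem taylorCoeffLeft_mul_pow_le (hc : ContDiffOn ℝ ∞ h (Ioi 0))
    (hs : ∀ (k : ℕ) (x : ℝ), 0 < x → 0 ≤ (-1) ^ k * iteratedDeriv k h x) {N x : ℝ}
    (hx : 0 < x) (hxN : x < N) (n : ℕ) :
    ∑ k ∈ Finset.range (n + 1), taylorCoeffLeft h N k * (N - x) ^ k ≤ h x := by
  obtain ⟨y, hy, e⟩ := taylor_mean_remainder_lagrange_iteratedDeriv (n := n) hxN.ne'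
    (by exact_mod_cast contDiffOn_uIcc_of_Ioi hc hx hxN (n + 1))
  rw [taylorWithinEval_eq_sum_taylorCoeffLeft hc hx hxN] at e
  rw [uIoo_of_ge hxN.le] at hy
  have h1 : 0 ≤ iteratedDeriv (n + 1) h y * (x - N) ^ (n + 1) / (n + 1).factorial := by
    have := hs (n + 1) y (hx.trans hy.1)
    rw [← neg_sub N x, neg_pow (N - x)]
    have h2 : 0 ≤ (N - x) ^ (n + 1) := pow_nonneg (by linarith) _
    have := mul_nonneg this h2
    refine div_nonneg (this.trans_eq (by ring)) (by positivity)
  linarith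

theorem taylorCoeffLeft_nonneg
    (hs : ∀ (k : ℕ) (x : ℝ), 0 < x → 0 ≤ (-1) ^ k * iteratedDeriv k h x) {N : ℝ}
    (hN : 0 < N) (k : ℕ) : 0 ≤ taylorCoeffLeft h N k :=
  div_nonneg (hs k N hN) (by positivity)

/-- The Cauchy remainder tends to zero: a point `r` in `(0, x)` leaves room to bound the coefficient
at the intermediate point `y` by `h r / (y - r) ^ (n + 1)`, and `(y - x) / (y - r)` stays below `q <
1`. -/
theorem hasSum_taylorCoeffLeft (hc : ContDiffOn ℝ ∞ h (Ioi 0))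
    (hs : ∀ (k : ℕ) (x : ℝ), 0 < x → 0 ≤ (-1) ^ k * iteratedDeriv k h x) {N x : ℝ}
    (hx : 0 < x) (hxN : x < N) :
    HasSum (fun k => taylorCoeffLeft h N k * (N - x) ^ k) (h x) := by
  rw [hasSum_iff_tendsto_nat_of_nonneg
    (fun k => mul_nonneg (taylorCoeffLeft_nonneg hs (hx.trans hxN) k) (pow_nonneg (by linarith) _)),
    ← tendsto_add_atTop_iff_nat 1]
  obtain ⟨r, hr, hrx⟩ := exists_between hx
  set q := (N - x) / (N - r) with hq
  have hq0 : 0 ≤ q := div_nonneg (by linarith) (by linarith)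
  have hq1 : q < 1 := by rw [hq, div_lt_one (by linarith)]; linarith
  have hlim : Tendsto (fun n : ℕ => h r * (N - x) / (x - r) * ((n + 1) * q ^ n)) atTop (𝓝 0) := by
    have h1 := tendsto_self_mul_const_pow_of_lt_one hq0 hq1
    have h2 := tendsto_pow_atTop_nhds_zero_of_lt_one hq0 hq1
    simpa [add_mul] using (h1.add h2).const_mul (h r * (N - x) / (x - r))
  have hup : ∀ n : ℕ, h x - h r * (N - x) / (x - r) * ((n + 1) * q ^ n) ≤
      ∑ k ∈ Finset.range (n + 1), taylorCoeffLeft h N k * (N - x) ^ k := by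
    intro n
    have hcd := contDiffOn_uIcc_of_Ioi hc hx hxN (n + 1)
    have hu : UniqueDiffOn ℝ (uIcc N x) := uniqueDiffOn_uIcc hxN.ne'
    obtain ⟨y, hy, e⟩ := taylor_mean_remainder_cauchy (n := n) hxN.ne'
      (contDiffOn_uIcc_of_Ioi hc hx hxN n)
      ((hcd.differentiableOn_iteratedDerivWithin (by norm_cast; simp) hu).mono Ioo_subset_Icc_self)
    rw [taylorWithinEval_eq_sum_taylorCoeffLeft hc hx hxN] at e
    rw [uIoo_of_ge hxN.le] at hy
    rw [iteratedDerivWithin_eq_iteratedDeriv hu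
      ((hc.contDiffAt (Ioi_mem_nhds (hx.trans hy.1))).of_le (by exact_mod_cast le_top))
      (by rw [uIcc_of_ge hxN.le]; exact Ioo_subset_Icc_self hy)] at e
    have hry : r < y := hrx.trans hy.1
    have hle : taylorCoeffLeft h y (n + 1) * (y - r) ^ (n + 1) ≤ h r := by
      refine le_trans ?_ (taylorCoeffLeft_mul_pow_le hc hs hr hry (n + 1))
      exact Finset.single_le_sum (f := fun k => taylorCoeffLeft h y k * (y - r) ^ k)
        (fun k _ => mul_nonneg (taylorCoeffLeft_nonneg hs (hx.trans hy.1) k)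
          (pow_nonneg (by linarith) _)) (by simp)
    have e2 : iteratedDeriv (n + 1) h y * (x - y) ^ n / n.factorial * (x - N) =
        taylorCoeffLeft h y (n + 1) * ((n + 1) * (y - x) ^ n * (N - x)) := by
      rw [taylorCoeffLeft, ← neg_sub y x, neg_pow (y - x), Nat.factorial_succ]
      push_cast
      field_simp
      ring
    rw [e2] at e
    have hyr : 0 < y - r := by linarith
    have h3 : taylorCoeffLeft h y (n + 1) ≤ h r / (y - r) ^ (n + 1) := by
      rwa [le_div_iff₀ (by positivity)]
    have hr0 : 0 ≤ h r := by simpa using hs 0 r hr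
    have h4 : (y - x) / (y - r) ≤ q := by
      rw [hq, div_le_div_iff₀ hyr (by linarith)]
      nlinarith [hy.1, hy.2]
    have h5 : taylorCoeffLeft h y (n + 1) * ((n + 1) * (y - x) ^ n * (N - x)) ≤
        h r * (N - x) / (x - r) * ((n + 1) * q ^ n) := by
      calc _ ≤ h r / (y - r) ^ (n + 1) * ((n + 1) * (y - x) ^ n * (N - x)) := by
            have : 0 ≤ y - x := by linarith [hy.1]
            have : 0 ≤ N - x := by linarith
            gcongr
        _ = h r * (N - x) / (y - r) * ((n + 1) * ((y - x) / (y - r)) ^ n) := by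
            rw [div_pow]; field_simp; ring
        _ ≤ _ := by
            have : 0 ≤ y - x := by linarith [hy.1]
            have : 0 ≤ N - x := by linarith
            have : 0 < x - r := by linarith
            have : x - r ≤ y - r := by linarith [hy.1]
            gcongr
    linarith
  exact tendsto_of_tendsto_of_tendsto_of_le_of_le (by simpa using hlim.const_sub (h x))
    tendsto_const_nhds hup (fun n => taylorCoeffLeft_mul_pow_le hc hs hx hxN n)

/-- The bases differ by at most `z ^ 2`, and the factor `k` from the difference of powers is
absorbed by `m z exp (-m z) ≤ 1`. The bound must not depend on `k`. -/
theorem abs_pow_sub_exp_le {z : ℝ} (hz : 0 ≤ z) (hz1 : z ≤ 1) (k : ℕ) :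
    |(1 - z) ^ k - Real.exp (-(k * z))| ≤ 2 * z := by
  rcases k with _ | m
  · simpa using hz
  have hb : 1 - z ≤ Real.exp (-z) := by linarith [Real.add_one_le_exp (-z)]
  have hba : Real.exp (-z) - (1 - z) ≤ z ^ 2 := by
    have h1 : Real.exp (-z) * (1 + z) ≤ 1 := by
      calc _ ≤ Real.exp (-z) * Real.exp z := by gcongr; linarith [Real.add_one_le_exp z]
        _ = 1 := by rw [← Real.exp_add]; simp
    have h2 : Real.exp (-z) ≤ 1 / (1 + z) := by rwa [le_div_iff₀ (by positivity)]
    have h3 : 1 / (1 + z) ≤ 1 - z + z ^ 2 := by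
      rw [div_le_iff₀ (by positivity)]
      nlinarith [pow_nonneg hz 3]
    linarith
  have he : Real.exp (-((m + 1 : ℕ) * z)) = Real.exp (-z) ^ (m + 1) := by
    rw [← Real.exp_nat_mul]; ring_nf
  have hmz : (m * z) * Real.exp (-z) ^ m ≤ 1 := by
    rw [← Real.exp_nat_mul]
    calc (m * z) * Real.exp (m * -z) ≤ Real.exp (m * z) * Real.exp (m * -z) := by
          gcongr; linarith [Real.add_one_le_exp (m * z)]
      _ = 1 := by rw [← Real.exp_add]; simp
  have hm1 : Real.exp (-z) ^ m ≤ 1 := pow_le_one₀ (Real.exp_pos _).le (by simpa using hz)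
  rw [he]
  refine (abs_pow_sub_pow_le _ _ _).trans ?_
  rw [abs_sub_comm, abs_of_nonneg (sub_nonneg.2 hb), abs_of_nonneg (sub_nonneg.2 hz1),
    abs_of_pos (Real.exp_pos _), max_eq_right hb, Nat.add_sub_cancel]
  push_cast
  calc (Real.exp (-z) - (1 - z)) * (m + 1) * Real.exp (-z) ^ m
      ≤ z ^ 2 * (m + 1) * Real.exp (-z) ^ m := by gcongr
    _ = z * ((m * z) * Real.exp (-z) ^ m + z * Real.exp (-z) ^ m) := by ring
    _ ≤ z * (1 + 1 * 1) := by gcongr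
    _ = 2 * z := by ring

variable {E : Type*} [NormedAddCommGroup E] [InnerProductSpace ℝ E] [FiniteDimensional ℝ E]

theorem posDefFunction_hasSum_gaussian {a b : ℕ → ℝ} {F : E → ℝ} (ha : ∀ k, 0 ≤ a k)
    (hb : ∀ k, 0 ≤ b k) (hF : ∀ x, HasSum (fun k => a k * Real.exp (-b k * ‖x‖ ^ 2)) (F x)) :
    PosDefFunction (fun x => (F x : ℂ)) := by
  refine PosDefFunction.of_tendsto (l := atTop)
    (Φ := fun (s : Finset ℕ) x => ∑ k ∈ s, (a k : ℂ) * (Real.exp (-b k * ‖x‖ ^ 2) : ℂ))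
    (Eventually.of_forall fun s => PosDefFunction.sum s fun k _ =>
      (posDefFunction_gaussian (hb k)).const_mul (ha k)) fun x => ?_
  simpa [HasSum] using Complex.hasSum_ofReal.2 (hF x)

theorem posDefFunction_shift_of_alternating (hc : ContDiffOn ℝ ∞ h (Ioi 0))
    (hs : ∀ (k : ℕ) (x : ℝ), 0 < x → 0 ≤ (-1) ^ k * iteratedDeriv k h x) {ε : ℝ} (hε : 0 < ε) :
    PosDefFunction (fun x : E => (h (‖x‖ ^ 2 + ε) : ℂ)) := by
  -- Expanding about `M + ε` gives the powers `M ^ k` at `ε`, so these weights have total mass `h ε`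
  -- for every `M`.
  have hA : ∀ M : ℝ, 0 < M →
      HasSum (fun k => taylorCoeffLeft h (M + ε) k * M ^ k) (h ε) := fun M hM => by
    simpa using hasSum_taylorCoeffLeft hc hs hε (show ε < M + ε by linarith)
  have ha0 : ∀ M : ℝ, 0 < M → ∀ k, 0 ≤ taylorCoeffLeft h (M + ε) k * M ^ k := fun M hM k =>
    mul_nonneg (taylorCoeffLeft_nonneg hs (by positivity) k) (by positivity)
  have hB : ∀ M : ℝ, 0 < M → ∀ y : ℝ, 0 ≤ y → Summable (fun k : ℕ =>
      taylorCoeffLeft h (M + ε) k * M ^ k * Real.exp (-(k / M) * y)) := fun M hM y hy => by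
    refine (hA M hM).summable.of_nonneg_of_le
      (fun k => mul_nonneg (ha0 M hM k) (Real.exp_pos _).le) fun k => ?_
    refine mul_le_of_le_one_right (ha0 M hM k) (Real.exp_le_one_iff.2 ?_)
    have : 0 ≤ k / M * y := by positivity
    linarith
  refine PosDefFunction.of_tendsto (l := atTop) (Φ := fun (M : ℝ) x =>
    ((∑' k : ℕ, taylorCoeffLeft h (M + ε) k * M ^ k * Real.exp (-(k / M) * ‖x‖ ^ 2) : ℝ) : ℂ))
    ?_ fun x => ?_
  · filter_upwards [eventually_gt_atTop 0] with M hM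
    exact posDefFunction_hasSum_gaussian (ha0 M hM) (fun k => by positivity)
      fun x => (hB M hM _ (by positivity)).hasSum
  · refine (Complex.continuous_ofReal.tendsto _).comp ?_
    have hy : 0 ≤ ‖x‖ ^ 2 := by positivity
    generalize ‖x‖ ^ 2 = y at hy
    rw [tendsto_iff_dist_tendsto_zero]
    have hlim : Tendsto (fun M : ℝ => h ε * (2 * (y / M))) atTop (𝓝 0) := by
      simpa using ((tendsto_const_nhds (x := y)).div_atTop tendsto_id).const_mul 2 |>.const_mul (h ε)
    refine squeeze_zero' (Eventually.of_forall fun _ => dist_nonneg) ?_ hlim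
    filter_upwards [eventually_gt_atTop 0, eventually_gt_atTop y] with M hM hyM
    have h1 : HasSum (fun k => taylorCoeffLeft h (M + ε) k * M ^ k * (1 - y / M) ^ k)
        (h (y + ε)) := by
      convert hasSum_taylorCoeffLeft hc hs (show 0 < y + ε by linarith)
        (show y + ε < M + ε by linarith) using 2 with k
      rw [mul_assoc, ← mul_pow]
      congr 2
      field_simp
      ring
    have h2 := ((hB M hM y hy).hasSum.sub h1)
    rw [dist_eq_norm]
    refine (h2.norm_le_of_bounded ((hA M hM).mul_right (2 * (y / M))) fun k => ?_)
    rw [← mul_sub, norm_mul, Real.norm_of_nonneg (ha0 M hM k), Real.norm_eq_abs, abs_sub_comm]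
    refine mul_le_mul_of_nonneg_left ?_ (ha0 M hM k)
    rw [show -(k / M) * y = -(k * (y / M)) by ring]
    exact abs_pow_sub_exp_le (by positivity) (by rw [div_le_one hM]; exact hyM.le) k

theorem IsCompletelyMonotonic.continuousOn {g : ℝ → ℝ} (hg : IsCompletelyMonotonic g)
    (hg0 : ContinuousWithinAt g (Ici 0) 0) : ContinuousOn g (Ici 0) := by
  intro y hy
  rcases eq_or_lt_of_le (show (0 : ℝ) ≤ y from hy) with rfl | hy
  · exact hg0
  · exact (hg.2.1.continuousOn.continuousAt (Ioi_mem_nhds hy)).continuousWithinAt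

/-- A completely monotonic function of the squared norm is positive definite. -/
theorem IsCompletelyMonotonic.posDefFunction {g : ℝ → ℝ} (hg : IsCompletelyMonotonic g)
    (hg0 : ContinuousWithinAt g (Ici 0) 0) :
    PosDefFunction (fun x : E => (g (‖x‖ ^ 2) : ℂ)) := by
  refine PosDefFunction.of_tendsto (l := 𝓝[>] (0 : ℝ)) (Φ := fun ε x => (g (‖x‖ ^ 2 + ε) : ℂ))
    ?_ fun x => ?_
  · filter_upwards [self_mem_nhdsWithin] with ε hε
    exact posDefFunction_shift_of_alternating hg.2.1 hg.2.2 hε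
  · refine (Complex.continuous_ofReal.tendsto _).comp ?_
    have hy : 0 ≤ ‖x‖ ^ 2 := by positivity
    refine (hg.continuousOn hg0 _ hy).tendsto.comp (tendsto_nhdsWithin_iff.2 ⟨?_, ?_⟩)
    · have : Tendsto (fun ε : ℝ => ‖x‖ ^ 2 + ε) (𝓝 0) (𝓝 (‖x‖ ^ 2 + 0)) := by
        exact (continuous_const.add continuous_id).tendsto 0
      rw [add_zero] at this
      exact this.mono_left nhdsWithin_le_nhds
    · filter_upwards [self_mem_nhdsWithin] with ε hε
      exact add_nonneg hy (le_of_lt hε)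

end CompletelyMonotone

/-! ### Non-negativity of the Fourier transform. -/

section FourierPositivity

open MeasureTheory ProbabilityTheory Filter Topology
open scoped FourierTransform NNReal

/-- Averaging positive definiteness over independent random points. -/
theorem PosDefFunction.integral_prod_nonneg {F : ℝ → ℂ} (hF : PosDefFunction F)
    (hc : Continuous F) {M : ℝ} (hb : ∀ x, ‖F x‖ ≤ M) (μ : Measure ℝ) [IsProbabilityMeasure μ] :
    0 ≤ ∫ p, F (p.1 - p.2) ∂(μ.prod μ) := by
  set J := ∫ p, F (p.1 - p.2) ∂(μ.prod μ) with hJ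
  -- Take `n` independent points with law `μ` and all coefficients 1: the diagonal contributes `n F
  -- 0` and each off-diagonal pair contributes `J`. Dividing by `n (n - 1)` removes the diagonal in
  -- the limit.
  have key : ∀ n : ℕ, 0 ≤ (n : ℂ) * F 0 + n * (n - 1) * J := by
    intro n
    set P := Measure.pi (fun _ : Fin n => μ) with hP
    have hint : ∀ j k : Fin n, Integrable (fun w : Fin n → ℝ => F (w j - w k)) P := fun j k =>
      (integrable_const M).mono' (by fun_prop) (Eventually.of_forall fun w => hb _)
    have h0 : 0 ≤ ∫ w, ∑ j, ∑ k, F (w j - w k) ∂P :=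
      integral_nonneg fun w => by simpa using hF n w (fun _ => 1)
    have hdiag : ∀ j k : Fin n, ∫ w, F (w j - w k) ∂P = if j = k then F 0 else J := by
      intro j k
      split_ifs with h
      · subst h; simp
      · have hind : IndepFun (fun w : Fin n → ℝ => w j) (fun w => w k) P :=
          (iIndepFun_pi (X := fun _ x => x) (fun _ => aemeasurable_id)).indepFun h
        have hmap := (indepFun_iff_map_prod_eq_prod_map_map
          (measurable_pi_apply j).aemeasurable (measurable_pi_apply k).aemeasurable).1 hind
        rw [(measurePreserving_eval (fun _ : Fin n => μ) j).map_eq,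
          (measurePreserving_eval (fun _ : Fin n => μ) k).map_eq] at hmap
        rw [hJ, ← hmap, integral_map (by fun_prop) (by fun_prop)]
    rw [integral_finsetSum _ fun j _ => integrable_finsetSum _ fun k _ => hint j k] at h0
    simp_rw [integral_finsetSum _ fun k _ => hint _ k, hdiag] at h0
    convert h0 using 1
    have : ∀ j : Fin n, ∑ k, (if j = k then F 0 else J) = F 0 + (n - 1) * J := by
      intro j
      have : ∀ k, (if j = k then F 0 else J) = (if j = k then F 0 - J else 0) + J := by
        intro k; split_ifs <;> ring
      simp_rw [this, Finset.sum_add_distrib]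
      simp
      ring
    simp_rw [this]
    simp
    ring
  refine ge_of_tendsto (x := atTop) (b := 0)
    (f := fun m : ℕ => ((1 / ((m : ℝ) + 1) : ℝ) : ℂ) * F 0 + J) ?_ (Eventually.of_forall fun m => ?_)
  · have := ((Complex.continuous_ofReal.tendsto 0).comp
      (tendsto_one_div_add_atTop_nhds_zero_nat (𝕜 := ℝ))).mul_const (F 0) |>.add_const J
    simpa using this
  · have h1 := mul_nonneg (Complex.zero_le_real.2
      (show (0 : ℝ) ≤ 1 / ((m + 2) * (m + 1)) by positivity)) (key (m + 2))
    convert h1 using 1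
    have h2 : (m : ℂ) + 1 ≠ 0 := by exact_mod_cast Nat.succ_ne_zero m
    have h3 : (m : ℂ) + 2 ≠ 0 := by exact_mod_cast Nat.succ_ne_zero (m + 1)
    push_cast
    field_simp
    ring

theorem integral_gaussianReal_prod_sub {F : ℝ → ℂ} (hc : Continuous F) (v : ℝ≥0) :
    ∫ p, F (p.1 - p.2) ∂((gaussianReal 0 v).prod (gaussianReal 0 v)) =
      ∫ x, F x ∂(gaussianReal 0 (v + v)) := by
  have h := gaussianReal_conv_gaussianReal (m₁ := 0) (m₂ := 0) (v₁ := v) (v₂ := v)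
  rw [add_zero] at h
  have hneg : (gaussianReal 0 v).map (fun x => -x) = gaussianReal 0 v := by
    simpa using gaussianReal_map_neg (μ := 0) (v := v)
  have hprod : ((gaussianReal 0 v).prod (gaussianReal 0 v)).map (Prod.map id (fun x => -x)) =
      (gaussianReal 0 v).prod (gaussianReal 0 v) := by
    rw [← Measure.map_prod_map _ _ measurable_id measurable_neg, hneg, Measure.map_id]
  rw [← h, Measure.conv, integral_map (by fun_prop) (by fun_prop), ← hprod,
    integral_map (by fun_prop) (by fun_prop), hprod]
  simp [sub_eq_add_neg]

/-- Averaging against a centred Gaussian of variance `2 (n + 1)` and clearing its normalisation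
leaves a weight that increases to 1, so dominated convergence applies. -/
theorem PosDefFunction.integral_nonneg {F : ℝ → ℂ} (hF : PosDefFunction F)
    (hc : Continuous F) {M : ℝ} (hb : ∀ x, ‖F x‖ ≤ M) (hi : Integrable F) : 0 ≤ ∫ x, F x := by
  have hpos : ∀ n : ℕ, 0 ≤ ∫ x : ℝ, ((Real.exp (-(x ^ 2 / (4 * (n + 1)))) : ℝ) : ℂ) * F x := by
    intro n
    have h := hF.integral_prod_nonneg hc hb (gaussianReal 0 (n + 1))
    rw [integral_gaussianReal_prod_sub hc,
      integral_gaussianReal_eq_integral_smul (by positivity)] at h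
    simp only [gaussianPDFReal_def, Complex.real_smul, Complex.ofReal_mul, mul_assoc] at h
    rw [integral_const_mul] at h
    have hpi : (0 : ℝ) < √(2 * (Real.pi * ((n + 1 + (n + 1) : ℝ≥0) : ℝ))) := by positivity
    have h2 := mul_nonneg (Complex.zero_le_real.2 hpi.le) h
    rw [← mul_assoc, ← Complex.ofReal_mul, mul_inv_cancel₀ hpi.ne', Complex.ofReal_one, one_mul]
      at h2
    refine h2.trans_eq (integral_congr_ae (Eventually.of_forall fun x => ?_))
    simp only
    congr 3
    push_cast
    rw [sub_zero, ← neg_div]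
    congr 1
    ring
  refine ge_of_tendsto' (tendsto_integral_of_dominated_convergence (fun x => ‖F x‖)
    (fun n => ?_) hi.norm (fun n => ?_) (Eventually.of_forall fun x => ?_)) hpos
  · fun_prop
  · refine Eventually.of_forall fun x => ?_
    rw [norm_mul, Complex.norm_real, Real.norm_of_nonneg (Real.exp_pos _).le]
    refine mul_le_of_le_one_left (norm_nonneg _) (Real.exp_le_one_iff.2 ?_)
    have : 0 ≤ x ^ 2 / (4 * (n + 1 : ℝ)) := by positivity
    linarith
  · have h1 : Tendsto (fun n : ℕ => -(x ^ 2 / 4 * (1 / ((n : ℝ) + 1)))) atTop (𝓝 0) := by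
      simpa using ((tendsto_one_div_add_atTop_nhds_zero_nat (𝕜 := ℝ)).const_mul (x ^ 2 / 4)).neg
    have h2 := ((Complex.continuous_ofReal.comp Real.continuous_exp).tendsto 0).comp h1
    have h3 := h2.mul_const (F x)
    simp only [Function.comp_def, Real.exp_zero, Complex.ofReal_one, one_mul] at h3
    refine h3.congr fun n => ?_
    congr 3
    field_simp

theorem PosDefFunction.fourier_nonneg {F : ℝ → ℂ} (hF : PosDefFunction F)
    (hc : Continuous F) {M : ℝ} (hb : ∀ x, ‖F x‖ ≤ M) (hi : Integrable F) (ξ : ℝ) :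
    0 ≤ 𝓕 F ξ := by
  rw [Real.fourier_real_eq_integral_exp_smul]
  simp only [smul_eq_mul]
  have hn : ∀ x : ℝ, ‖Complex.exp (((-2 * Real.pi * x * ξ : ℝ) : ℂ) * Complex.I)‖ = 1 :=
    fun x => Complex.norm_exp_ofReal_mul_I _
  refine PosDefFunction.integral_nonneg (M := M) (hF.character_mul fun x y => ?_) (by fun_prop)
    (fun x => by rw [norm_mul, hn, one_mul]; exact hb x) ?_
  · rw [← Complex.exp_conj, ← Complex.exp_add, map_mul, Complex.conj_I, Complex.conj_ofReal]
    congr 1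
    push_cast
    ring
  · exact hi.norm.mono' (by fun_prop) (Eventually.of_forall fun x => by
      rw [norm_mul, hn, one_mul])

end FourierPositivity

/-! ### Phragmén–Lindelöf and Liouville at critical growth. -/

section Hardy

open Filter Topology Set Complex

/-- Critical Phragmén–Lindelöf principle in a quadrant: growth `exp (B (re z)²)` and
boundedness on the real and imaginary axes force boundedness. -/
theorem norm_le_of_growth_exp_re_sq {G : ℂ → ℂ} (hG : Differentiable ℂ G) {B C : ℝ} (hB : 0 < B)
    (hgrow : ∀ z, ‖G z‖ ≤ C * Real.exp (B * z.re ^ 2)) (hre : ∀ x : ℝ, ‖G x‖ ≤ C) {z : ℂ}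
    (hx : 0 < z.re) (hy : 0 ≤ z.im) : ‖G z‖ ≤ C := by
  have hC : 0 ≤ C := (norm_nonneg _).trans (hre 0)
  have hz : z ≠ 0 := by rintro rfl; simp at hx
  have hlog : exp (log z) = z := exp_log hz
  -- The factor `exp (I ε z²)` has modulus `exp (-2 ε re z im z)`: it is harmless on the real axis
  -- and decays inside the quadrant. The condition on `z` describes a sector narrower than the
  -- quadrant.
  have key : ∀ ε : ℝ, 0 < ε → 2 * ε * z.im ≤ B * z.re →
      ‖G z * exp (I * ε * z ^ 2)‖ ≤ C := by
    intro ε hε hzε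
    -- On the ray of angle `θ` the decay cancels the growth `B (re z)²` exactly.
    set θ := Real.arctan (B / (2 * ε)) with hθ
    have hθ0 : 0 < θ := by rw [hθ, Real.arctan_pos]; positivity
    have hθ2 : θ < Real.pi / 2 := Real.arctan_lt_pi_div_two _
    have hcos : 0 < Real.cos θ := Real.cos_pos_of_mem_Ioo ⟨by linarith, hθ2⟩
    have hsin : 2 * ε * Real.sin θ = B * Real.cos θ := by
      have : Real.tan θ = B / (2 * ε) := Real.tan_arctan _
      rw [Real.tan_eq_sin_div_cos] at this
      field_simp at this
      linarith
    have hnorm : ∀ w : ℂ, ‖G w * exp (I * ε * w ^ 2)‖ ≤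
        C * Real.exp (B * w.re ^ 2 - 2 * ε * w.re * w.im) := by
      intro w
      have e : (I * ε * w ^ 2).re = -(2 * ε * w.re * w.im) := by
        simp [pow_two]; ring
      rw [norm_mul, norm_exp, e, sub_eq_add_neg, Real.exp_add, ← mul_assoc]
      gcongr
      exact hgrow w
    -- The substitution `z = exp w` turns the sector into a strip of width `θ`. The growth exponent
    -- 2 is admissible because `θ < π / 2`.
    have hstrip := PhragmenLindelof.horizontal_strip (a := 0) (b := θ) (C := C)
      (f := fun w => G (exp w) * exp (I * ε * (exp w) ^ 2)) (z := log z)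
      (Differentiable.diffContOnCl (by fun_prop)) ⟨2, ?_, B, ?_⟩ ?_ ?_ ?_ ?_
    · simpa only [hlog] using hstrip
    · rw [sub_zero, lt_div_iff₀ hθ0]; linarith
    · refine Asymptotics.IsBigO.of_bound C ?_
      refine eventually_inf_principal.2 (Eventually.of_forall fun w hw => ?_)
      refine (hnorm _).trans ?_
      rw [Real.norm_of_nonneg (Real.exp_pos _).le]
      gcongr
      have him : 0 ≤ (exp w).im := by
        rw [exp_im]
        exact mul_nonneg (Real.exp_pos _).le
          (Real.sin_nonneg_of_mem_Icc ⟨hw.1.le, by have := hw.2; linarith⟩)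
      have hre' : 0 ≤ (exp w).re := by
        rw [exp_re]
        exact mul_nonneg (Real.exp_pos _).le (Real.cos_nonneg_of_mem_Icc
          ⟨by have := hw.1; linarith [Real.pi_pos], by have := hw.2; linarith⟩)
      have hsq : (exp w).re ^ 2 ≤ Real.exp (2 * |w.re|) := by
        rw [exp_re, mul_pow, ← Real.exp_nat_mul]
        have h1 := Real.cos_sq_le_one w.im
        have h2 : Real.exp ((2 : ℕ) * w.re) ≤ Real.exp (2 * |w.re|) := by
          push_cast; gcongr; exact le_abs_self _
        calc _ ≤ Real.exp ((2 : ℕ) * w.re) * 1 := by gcongr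
          _ ≤ _ := by simpa using h2
      have h4 : 0 ≤ 2 * ε * (exp w).re * (exp w).im := by positivity
      have h5 := mul_le_mul_of_nonneg_left hsq hB.le
      linarith
    · intro w hw
      have e : exp w = (Real.exp w.re : ℂ) := by
        conv_lhs => rw [← re_add_im w, hw]
        simp
      simp only [e]
      rw [norm_mul, norm_exp]
      have : (I * ε * (Real.exp w.re : ℂ) ^ 2).re = 0 := by
        rw [← ofReal_pow, mul_assoc, ← ofReal_mul, I_mul_re, ofReal_im, neg_zero]
      rw [this]
      simpa using hre (Real.exp w.re)
    · intro w hw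
      refine (hnorm _).trans_eq ?_
      have : B * (exp w).re ^ 2 - 2 * ε * (exp w).re * (exp w).im = 0 := by
        rw [exp_re, exp_im, hw]
        linear_combination (-(Real.exp w.re ^ 2 * Real.cos θ)) * hsin
      rw [this]; simp
    · rw [log_im]; exact arg_nonneg_iff.2 hy
    · have harg : |arg z| < Real.pi / 2 := abs_arg_lt_pi_div_two_iff.2 (Or.inl hx)
      rw [log_im, hθ, ← Real.arctan_tan (abs_lt.1 harg).1 (abs_lt.1 harg).2, tan_arg]
      refine Real.arctan_strictMono.monotone ?_
      rw [div_le_div_iff₀ hx (by positivity)]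
      linarith
  have hlim : Tendsto (fun ε : ℝ => ‖G z * exp (I * ε * z ^ 2)‖) (𝓝[>] 0) (𝓝 ‖G z‖) := by
    have : Continuous fun ε : ℝ => ‖G z * exp (I * ε * z ^ 2)‖ := by fun_prop
    simpa using (this.tendsto 0).mono_left nhdsWithin_le_nhds
  refine le_of_tendsto hlim ?_
  have hev : ∀ᶠ ε : ℝ in 𝓝 0, 2 * ε * z.im < B * z.re := by
    have : Continuous fun ε : ℝ => 2 * ε * z.im := by fun_prop
    exact (this.tendsto 0).eventually_lt_const (by simp; positivity)
  filter_upwards [self_mem_nhdsWithin, nhdsWithin_le_nhds hev] with ε h1 h2 using key ε h1 h2.le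

/-- Conjugation and `z ↦ -z` carry the quadrant bound to the other quadrants, the growth hypothesis
itself covers the imaginary axis, and Liouville's theorem concludes. -/
theorem eq_const_of_growth_exp_re_sq {G : ℂ → ℂ} (hG : Differentiable ℂ G) {B C : ℝ} (hB : 0 < B)
    (hgrow : ∀ z, ‖G z‖ ≤ C * Real.exp (B * z.re ^ 2)) (hre : ∀ x : ℝ, ‖G x‖ ≤ C) (z : ℂ) :
    G z = G 0 := by
  have hright : ∀ (G : ℂ → ℂ), Differentiable ℂ G →
      (∀ z, ‖G z‖ ≤ C * Real.exp (B * z.re ^ 2)) → (∀ x : ℝ, ‖G x‖ ≤ C) →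
      ∀ z : ℂ, 0 < z.re → ‖G z‖ ≤ C := by
    intro G hG hgrow hre z hz
    rcases le_total 0 z.im with hy | hy
    · exact norm_le_of_growth_exp_re_sq hG hB hgrow hre hz hy
    · have := norm_le_of_growth_exp_re_sq (G := fun z => starRingEnd ℂ (G (starRingEnd ℂ z)))
        (z := starRingEnd ℂ z) 
        (fun z => by simpa [Function.comp_def] using (hG (starRingEnd ℂ z)).conj_conj) hB
        (fun w => by simpa using hgrow (starRingEnd ℂ w)) (fun x => by simpa using hre x)
        (by simpa using hz) (by simpa using hy)
      simpa using this
  have hall : ∀ z, ‖G z‖ ≤ C := by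
    intro z
    rcases lt_trichotomy z.re 0 with h | h | h
    · have := hright (fun z => G (-z)) (hG.comp differentiable_neg)
        (fun w => by simpa using hgrow (-w)) (fun x => by simpa using hre (-x)) (-z)
        (by simpa using h)
      simpa using this
    · simpa [h] using hgrow z
    · exact hright G hG hgrow hre z h
  exact hG.apply_eq_apply_of_bounded ((Metric.isBounded_closedBall (x := 0) (r := C)).subset
    (by rintro _ ⟨w, rfl⟩; simpa using hall w)) z 0

end Hardy

/-! ### Rigidity of Gaussian splittings on the line. -/

section GaussianSplitting

open Filter Topology MeasureTheory ProbabilityTheory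
open scoped FourierTransform Real

theorem integral_exp_neg_pi_mul_sq_add (x : ℝ) :
    ∫ ξ : ℝ, Real.exp (-π * ξ ^ 2 + 2 * π * x * ξ) = Real.exp (π * x ^ 2) := by
  have h1 : ∀ ξ : ℝ, Real.exp (-π * ξ ^ 2 + 2 * π * x * ξ) =
      Real.exp (π * x ^ 2) * Real.exp (-π * (ξ - x) ^ 2) := fun ξ => by
    rw [← Real.exp_add]; ring_nf
  simp_rw [h1]
  rw [integral_const_mul, integral_sub_right_eq_self (fun ξ : ℝ => Real.exp (-π * ξ ^ 2)),
    integral_gaussian, div_self Real.pi_ne_zero, Real.sqrt_one, mul_one]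

/-- A non-integrable function has integral 0 by convention, whereas the value just computed is
positive. -/
theorem integrable_exp_neg_pi_mul_sq_add (x : ℝ) :
    Integrable (fun ξ : ℝ => Real.exp (-π * ξ ^ 2 + 2 * π * x * ξ)) := by
  by_contra h
  have := integral_undef h
  rw [integral_exp_neg_pi_mul_sq_add] at this
  exact (Real.exp_pos _).ne' this

/-- Hardy's uncertainty principle for the critical Gaussian, for a non-negative spectral density. -/
theorem eq_gaussian_of_spectral_bound {u ρ : ℝ → ℝ} {c : ℝ} (hρc : Continuous ρ)
    (hρ0 : ∀ ξ, 0 ≤ ρ ξ) (hρ : ∀ ξ, ρ ξ ≤ c * Real.exp (-π * ξ ^ 2))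
    (hu : ∀ x, |u x| ≤ c * Real.exp (-π * x ^ 2))
    (hinv : ∀ x : ℝ, (u x : ℂ) = ∫ ξ : ℝ, Complex.exp (2 * π * x * ξ * Complex.I) * ρ ξ) (x : ℝ) :
    u x = u 0 * Real.exp (-π * x ^ 2) := by
  set μ := (volume : Measure ℝ).withDensity (fun ξ => ENNReal.ofReal (ρ ξ)) with hμ
  set X : ℝ → ℝ := fun ξ => 2 * π * ξ with hX
  have hm : Measurable (fun ξ => ENNReal.ofReal (ρ ξ)) := by fun_prop
  have hle : ∀ t ξ : ℝ, ρ ξ * Real.exp (t * X ξ) ≤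
      c * Real.exp (-π * ξ ^ 2 + 2 * π * t * ξ) := fun t ξ => by
    rw [show t * X ξ = 2 * π * t * ξ by simp only [hX]; ring, Real.exp_add, ← mul_assoc]
    exact mul_le_mul_of_nonneg_right (hρ ξ) (Real.exp_pos _).le
  have hint : ∀ t, Integrable (fun ξ => ρ ξ * Real.exp (t * X ξ)) := fun t =>
    ((integrable_exp_neg_pi_mul_sq_add t).const_mul c).mono' (by fun_prop)
      (Eventually.of_forall fun ξ => by
        rw [Real.norm_of_nonneg (mul_nonneg (hρ0 ξ) (Real.exp_pos _).le)]
        exact hle t ξ)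
  -- All exponential moments of the spectral measure are finite, so `complexMGF` is entire and
  -- extends `u` along the imaginary axis.
  have hset : integrableExpSet X μ = Set.univ := by
    refine Set.eq_univ_of_forall fun t => ?_
    change Integrable _ _
    rw [hμ, integrable_withDensity_iff_integrable_smul' hm (by simp)]
    refine (hint t).congr (Eventually.of_forall fun ξ => ?_)
    simp [ENNReal.toReal_ofReal (hρ0 ξ)]
  have hdiff : Differentiable ℂ (complexMGF X μ) := fun z =>
    (hasDerivAt_complexMGF (by rw [hset, interior_univ]; trivial)).differentiableAt
  have hmgf : ∀ t, mgf X μ t ≤ c * Real.exp (π * t ^ 2) := fun t => by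
    rw [mgf, hμ, integral_withDensity_eq_integral_toReal_smul hm (by simp),
      ← integral_exp_neg_pi_mul_sq_add, ← integral_const_mul]
    refine integral_mono ((hint t).congr (Eventually.of_forall fun ξ => ?_))
      ((integrable_exp_neg_pi_mul_sq_add t).const_mul c) fun ξ => ?_
    · simp [ENNReal.toReal_ofReal (hρ0 ξ)]
    · simpa [ENNReal.toReal_ofReal (hρ0 ξ)] using hle t ξ
  have hline : ∀ s : ℝ, complexMGF X μ (Complex.I * s) = u s := fun s => by
    rw [hinv, complexMGF, hμ, integral_withDensity_eq_integral_toReal_smul hm (by simp)]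
    refine integral_congr_ae (Eventually.of_forall fun ξ => ?_)
    simp only [ENNReal.toReal_ofReal (hρ0 ξ), hX, Complex.real_smul]
    rw [mul_comm]
    congr 2
    push_cast
    ring
  set G : ℂ → ℂ := fun z => complexMGF X μ (Complex.I * z) * Complex.exp (π * z ^ 2) with hG
  have hGd : Differentiable ℂ G := by
    have : Differentiable ℂ (fun z => complexMGF X μ (Complex.I * z)) :=
      hdiff.comp (differentiable_id.const_mul _)
    fun_prop
  have hGline : ∀ s : ℝ, G s = ((u s * Real.exp (π * s ^ 2) : ℝ) : ℂ) := fun s => by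
    simp only [hG, hline]
    push_cast
    rfl
  -- The moment bound gives `exp (π (im z)²)`, which cancels against `|exp (π z²)|` and leaves only
  -- `exp (π (re z)²)`.
  have hgrow : ∀ z, ‖G z‖ ≤ c * Real.exp (π * z.re ^ 2) := fun z => by
    have h1 := (norm_complexMGF_le_mgf (X := X) (μ := μ) (z := Complex.I * z)).trans (hmgf _)
    have h2 : ((π : ℂ) * z ^ 2).re = π * (z.re ^ 2 - z.im ^ 2) := by
      rw [Complex.re_ofReal_mul]; simp [pow_two]
    simp only [hG]
    rw [norm_mul, Complex.norm_exp, h2]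
    refine (mul_le_mul_of_nonneg_right h1 (Real.exp_pos _).le).trans_eq ?_
    rw [mul_assoc, ← Real.exp_add]
    congr 2
    simp
    ring
  have hreal : ∀ s : ℝ, ‖G s‖ ≤ c := fun s => by
    rw [hGline, Complex.norm_real, Real.norm_eq_abs, abs_mul, abs_of_pos (Real.exp_pos _)]
    calc _ ≤ c * Real.exp (-π * s ^ 2) * Real.exp (π * s ^ 2) := by gcongr; exact hu s
      _ = c := by rw [mul_assoc, ← Real.exp_add]; simp
  have h0 := eq_const_of_growth_exp_re_sq hGd Real.pi_pos hgrow hreal x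
  have h00 := hGline 0
  rw [Complex.ofReal_zero] at h00
  rw [h00, hGline] at h0
  have h3 : u x * Real.exp (π * x ^ 2) = u 0 := by
    have := Complex.ofReal_injective h0
    simpa using this
  rw [← h3, mul_assoc, ← Real.exp_add]
  simp

/-- A splitting of a Gaussian on the line into positive definite non-negative functions is
proportional. -/
theorem PosDefFunction.eq_gaussian_of_add {u v : ℝ → ℝ} {c : ℝ} (hu : Continuous u)
    (hv : Continuous v) (hup : PosDefFunction (fun x => (u x : ℂ)))
    (hvp : PosDefFunction (fun x => (v x : ℂ))) (hu0 : ∀ x, 0 ≤ u x) (hv0 : ∀ x, 0 ≤ v x)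
    (h : ∀ x, u x + v x = c * Real.exp (-π * x ^ 2)) (x : ℝ) :
    u x = u 0 * Real.exp (-π * x ^ 2) := by
  have hc : 0 ≤ c := by
    have := h 0
    simp at this
    linarith [hu0 0, hv0 0]
  have hgi : Integrable (fun x : ℝ => c * Real.exp (-π * x ^ 2)) :=
    (integrable_exp_neg_mul_sq Real.pi_pos).const_mul c
  have hbd : ∀ x : ℝ, c * Real.exp (-π * x ^ 2) ≤ c := fun x => by
    refine mul_le_of_le_one_right hc (Real.exp_le_one_iff.2 ?_)
    have : 0 ≤ π * x ^ 2 := by positivity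
    linarith
  have aux : ∀ w : ℝ → ℝ, Continuous w → (∀ x, 0 ≤ w x) →
      (∀ x, w x ≤ c * Real.exp (-π * x ^ 2)) → PosDefFunction (fun x => (w x : ℂ)) →
      Integrable (fun x => (w x : ℂ)) ∧ (∀ ξ, 0 ≤ 𝓕 (fun x => (w x : ℂ)) ξ) ∧ ∀ ξ : ℝ, Integrable
        fun x : ℝ => Complex.exp (((-2 * π * x * ξ : ℝ) : ℂ) * Complex.I) • (w x : ℂ) := by
    intro w hw hw0 hwle hwp
    have hi : Integrable (fun x => (w x : ℂ)) := hgi.mono' (by fun_prop)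
      (Eventually.of_forall fun x => by simpa [abs_of_nonneg (hw0 x)] using hwle x)
    refine ⟨hi, hwp.fourier_nonneg (M := c) (by fun_prop)
      (fun x => by simpa [abs_of_nonneg (hw0 x)] using (hwle x).trans (hbd x)) hi, fun ξ => ?_⟩
    exact hi.norm.mono' (by fun_prop) (Eventually.of_forall fun x => by
      rw [norm_smul, Complex.norm_exp_ofReal_mul_I, one_mul])
  obtain ⟨hui, huF, huI⟩ := aux u hu hu0 (fun x => by linarith [h x, hv0 x]) hup
  obtain ⟨-, hvF, hvI⟩ := aux v hv hv0 (fun x => by linarith [h x, hu0 x]) hvp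
  have hsum : ∀ ξ : ℝ, 𝓕 (fun x => (u x : ℂ)) ξ + 𝓕 (fun x => (v x : ℂ)) ξ =
      ((c * Real.exp (-π * ξ ^ 2) : ℝ) : ℂ) := by
    intro ξ
    have h1 := congrFun (fourier_gaussian_pi (b := 1) (by simp)) ξ
    simp only [Real.fourier_real_eq_integral_exp_smul] at h1 ⊢
    rw [← integral_add]
    · calc _ = ∫ x : ℝ, (c : ℂ) * (Complex.exp (((-2 * π * x * ξ : ℝ) : ℂ) * Complex.I) •
            Complex.exp (-π * 1 * x ^ 2)) := by
            refine integral_congr_ae (Eventually.of_forall fun x => ?_)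
            simp only [smul_eq_mul]
            rw [← mul_add, ← Complex.ofReal_add, h]
            push_cast
            ring_nf
        _ = _ := by
            rw [integral_const_mul, h1]
            simp
    · exact huI ξ
    · exact hvI ξ
  have hρ : ∀ ξ, 𝓕 (fun x => (u x : ℂ)) ξ = ((𝓕 (fun x => (u x : ℂ)) ξ).re : ℂ) := fun ξ =>
    Complex.ext rfl (by simpa using (Complex.nonneg_iff.1 (huF ξ)).2.symm)
  have hFc : Continuous (𝓕 (fun x => (u x : ℂ))) :=
    VectorFourier.fourierIntegral_continuous Real.continuous_fourierChar
      (L := innerₗ ℝ) continuous_inner hui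
  -- Non-negativity of the transform of `v` is what bounds the transform of `u` by the Gaussian.
  have hρle : ∀ ξ, (𝓕 (fun x => (u x : ℂ)) ξ).re ≤ c * Real.exp (-π * ξ ^ 2) := fun ξ => by
    have h1 := congrArg Complex.re (hsum ξ)
    rw [Complex.add_re, Complex.ofReal_re] at h1
    linarith [(Complex.nonneg_iff.1 (hvF ξ)).1]
  have hFi : Integrable (𝓕 (fun x => (u x : ℂ))) := hgi.mono' hFc.aestronglyMeasurable
    (Eventually.of_forall fun ξ => by
      rw [hρ ξ, Complex.norm_real, Real.norm_of_nonneg (Complex.nonneg_iff.1 (huF ξ)).1]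
      exact hρle ξ)
  have hinv := Continuous.fourierInv_fourier_eq (f := fun x => (u x : ℂ)) (by fun_prop) hui hFi
  refine eq_gaussian_of_spectral_bound (ρ := fun ξ => (𝓕 (fun x => (u x : ℂ)) ξ).re) (by fun_prop)
    (fun ξ => (Complex.nonneg_iff.1 (huF ξ)).1) hρle
    (fun x => by rw [abs_of_nonneg (hu0 x)]; linarith [h x, hv0 x]) (fun x => ?_) x
  have h2 := congrFun hinv x
  rw [Real.fourierInv_eq'] at h2
  rw [← h2]
  refine integral_congr_ae (Eventually.of_forall fun ξ => ?_)
  simp only [smul_eq_mul]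
  rw [← hρ ξ]
  congr 2
  simp
  ring

end GaussianSplitting

/-! ### Translates of completely monotonic functions. -/

section CompletelyMonotonicCalculus

open Set Filter Topology

variable {g : ℝ → ℝ}

theorem IsCompletelyMonotonic.antitoneOn_iteratedDeriv (hg : IsCompletelyMonotonic g) (k : ℕ) :
    AntitoneOn (fun x => (-1) ^ k * iteratedDeriv k g x) (Ioi 0) := by
  have hd : DifferentiableOn ℝ (iteratedDeriv k g) (Ioi 0) :=
    (hg.2.1.differentiableOn_iteratedDerivWithin (m := k) (by exact_mod_cast WithTop.coe_lt_top _)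
      (uniqueDiffOn_Ioi 0)).congr fun x hx => (iteratedDerivWithin_of_isOpen isOpen_Ioi hx).symm
  refine antitoneOn_of_deriv_nonpos (convex_Ioi 0) (hd.continuousOn.const_smul ((-1 : ℝ) ^ k))
    (by rw [interior_Ioi]; exact hd.const_mul _) fun x hx => ?_
  rw [interior_Ioi] at hx
  have h1 := hg.2.2 (k + 1) x hx
  rw [iteratedDeriv_succ, pow_succ] at h1
  rw [deriv_const_mul _ (hd.differentiableAt (Ioi_mem_nhds hx))]
  linarith

theorem IsCompletelyMonotonic.antitoneOn (hg : IsCompletelyMonotonic g)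
    (hg0 : ContinuousWithinAt g (Ici 0) 0) : AntitoneOn g (Ici 0) := by
  have h1 : AntitoneOn g (Ioi 0) := by simpa using hg.antitoneOn_iteratedDeriv 0
  intro x hx y hy hxy
  rcases eq_or_lt_of_le (show (0 : ℝ) ≤ x from hx) with rfl | hx
  · rcases eq_or_lt_of_le hxy with rfl | hy
    · exact le_rfl
    · refine ge_of_tendsto (hg0.tendsto.mono_left (nhdsWithin_mono 0 Ioi_subset_Ici_self)) ?_
      filter_upwards [Ioo_mem_nhdsGT hy] with z hz using h1 hz.1 hy hz.2.le
  · exact h1 hx (hx.trans_le hxy) hxy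

theorem continuousWithinAt_comp_add (hg : ContinuousOn g (Ici 0)) {δ : ℝ} (hδ : 0 ≤ δ) :
    ContinuousWithinAt (fun x => g (x + δ)) (Ici 0) 0 :=
  (hg.comp (by fun_prop) fun x (hx : 0 ≤ x) => add_nonneg hx hδ) 0 Set.self_mem_Ici

theorem IsCompletelyMonotonic.comp_add (hg : IsCompletelyMonotonic g) {δ : ℝ} (hδ : 0 ≤ δ) :
    IsCompletelyMonotonic (fun x => g (x + δ)) := by
  refine ⟨fun x hx => hg.1 _ (by positivity), ?_, fun k x hx => ?_⟩
  · exact hg.2.1.comp (by fun_prop) fun x (hx : 0 < x) => add_pos_of_pos_of_nonneg hx hδ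
  · rw [iteratedDeriv_comp_add_const]
    exact hg.2.2 k _ (by positivity)

/-- Each `(-1) ^ k * iteratedDeriv k g` is antitone, so subtracting a right translate keeps every
sign. -/
theorem IsCompletelyMonotonic.sub_comp_add (hg : IsCompletelyMonotonic g)
    (hg0 : ContinuousWithinAt g (Ici 0) 0) {δ : ℝ} (hδ : 0 ≤ δ) :
    IsCompletelyMonotonic (fun x => g x - g (x + δ)) := by
  have hs := hg.comp_add hδ
  refine ⟨fun x hx => sub_nonneg.2 (hg.antitoneOn hg0 hx (add_nonneg hx hδ) (by linarith)),
    hg.2.1.sub hs.2.1, fun k x hx => ?_⟩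
  have hxδ : 0 < x + δ := by positivity
  rw [iteratedDeriv_fun_sub
    ((hg.2.1.contDiffAt (Ioi_mem_nhds hx)).of_le (by exact_mod_cast le_top))
    ((hs.2.1.contDiffAt (Ioi_mem_nhds hx)).of_le (by exact_mod_cast le_top)),
    iteratedDeriv_comp_add_const, mul_sub]
  exact sub_nonneg.2 (hg.antitoneOn_iteratedDeriv k hx hxδ (by linarith))

/-- A completely monotonic function whose translates are all proportional to it is exponential. -/
theorem IsCompletelyMonotonic.eq_exp_of_translates (hg : IsCompletelyMonotonic g)
    (hg0 : ContinuousWithinAt g (Ici 0) 0)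
    (ht : ∀ δ, 0 < δ → ∃ t : ℝ, ∀ x, 0 ≤ x → g (x + δ) = t * g x) :
    ∃ c a : ℝ, 0 ≤ c ∧ 0 ≤ a ∧ ∀ x, 0 ≤ x → g x = c * Real.exp (-a * x) := by
  have hdiff : ∀ x, 0 < x → DifferentiableAt ℝ g x := fun x hx =>
    (hg.2.1.contDiffAt (Ioi_mem_nhds hx)).differentiableAt (by simp)
  suffices h : ∃ c a : ℝ, 0 ≤ c ∧ 0 ≤ a ∧ ∀ x, 0 < x → g x = c * Real.exp (-a * x) by
    obtain ⟨c, a, hc, ha, h⟩ := h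
    refine ⟨c, a, hc, ha, fun x hx => ?_⟩
    rcases eq_or_lt_of_le hx with rfl | hx
    · refine tendsto_nhds_unique (hg0.tendsto.mono_left (nhdsWithin_mono 0 Ioi_subset_Ici_self))
        (Tendsto.congr' (f₁ := fun x => c * Real.exp (-a * x)) ?_ ?_)
      · filter_upwards [self_mem_nhdsWithin] with x hx using (h x hx).symm
      · have : Continuous fun x => c * Real.exp (-a * x) := by fun_prop
        exact (this.tendsto 0).mono_left nhdsWithin_le_nhds
    · exact h x hx
  by_cases hz : ∃ x₀, 0 < x₀ ∧ 0 < g x₀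
  · obtain ⟨x₀, hx₀, hgx₀⟩ := hz
    -- With `δ = z - x`, the relation and its derivative at `x` have the same factor `t`, so
    -- eliminating `t` shows that the logarithmic derivative is constant.
    have hlt : ∀ x z, 0 < x → x < z → deriv g z * g x = deriv g x * g z := by
      intro x z hx hxz
      obtain ⟨t, ht⟩ := ht (z - x) (by linarith)
      have h1 : (fun y => g (y + (z - x))) =ᶠ[𝓝 x] fun y => t * g y := by
        filter_upwards [Ioi_mem_nhds hx] with y hy using ht y (le_of_lt hy)
      have h2 := h1.deriv_eq
      rw [deriv_comp_add_const, deriv_const_mul _ (hdiff x hx), add_sub_cancel] at h2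
      have h3 := ht x hx.le
      rw [add_sub_cancel] at h3
      rw [h2, h3]
      ring
    have hall : ∀ y, 0 < y → deriv g y * g x₀ = deriv g x₀ * g y := by
      intro y hy
      rcases lt_trichotomy x₀ y with h | rfl | h
      · exact hlt x₀ y hx₀ h
      · rfl
      · linarith [hlt y x₀ hy h]
    set a := -deriv g x₀ / g x₀ with ha
    have ha0 : 0 ≤ a := by
      have := hg.2.2 1 x₀ hx₀
      rw [iteratedDeriv_one] at this
      exact div_nonneg (by linarith) hgx₀.le
    have hode : ∀ y, 0 < y → deriv g y = -a * g y := by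
      intro y hy
      rw [ha]
      field_simp
      linarith [hall y hy]
    have hK : ∀ y ∈ Ioi (0 : ℝ), HasDerivAt (fun y => g y * Real.exp (a * y)) 0 y := by
      intro y hy
      have h1 := (hdiff y hy).hasDerivAt
      have h2 : HasDerivAt (fun y => Real.exp (a * y)) (Real.exp (a * y) * (a * 1)) y :=
        ((hasDerivAt_id y).const_mul a).exp
      refine (h1.mul h2).congr_deriv ?_
      rw [hode y hy]
      ring
    obtain ⟨c, hc⟩ := isOpen_Ioi.exists_is_const_of_deriv_eq_zero (convex_Ioi (0 : ℝ)).isPreconnected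
      (fun y hy => (hK y hy).differentiableAt.differentiableWithinAt)
      (fun y hy => (hK y hy).deriv)
    refine ⟨c, a, ?_, ha0, fun x hx => ?_⟩
    · rw [← hc x₀ hx₀]; positivity
    · rw [← hc x hx, mul_assoc, ← Real.exp_add]; simp
  · push Not at hz
    exact ⟨0, 0, le_rfl, le_rfl, fun x hx => by
      simpa using le_antisymm (hz x hx) (hg.1 x hx.le)⟩

end CompletelyMonotonicCalculus

/-! ### The cone and its extremal rays. -/

section Cone

variable {d : ℕ}

theorem smul_mem_posPosDefCone {f : EuclideanSpace ℝ (Fin d) → ℝ} (hf : f ∈ posPosDefCone d)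
    {t : ℝ} (ht : 0 ≤ t) : t • f ∈ posPosDefCone d := by
  obtain ⟨hc, ⟨f₀, hf₀⟩, hp, h0⟩ := hf
  refine ⟨hc.const_smul t, ⟨fun r => t * f₀ r, fun x => by simp [hf₀]⟩, ?_,
    fun x => mul_nonneg ht (h0 x)⟩
  have := PosDefFunction.const_mul (F := fun x => (f x : ℂ)) hp ht
  simp only [← Complex.ofReal_mul] at this
  exact this

theorem IsCompletelyMonotonic.mem_posPosDefCone {g : ℝ → ℝ} (hg : IsCompletelyMonotonic g)
    (hg0 : ContinuousWithinAt g (Set.Ici 0) 0) :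
    (fun x : EuclideanSpace ℝ (Fin d) => g (‖x‖ ^ 2)) ∈ posPosDefCone d :=
  ⟨(hg.continuousOn hg0).comp_continuous (by fun_prop) fun x => by simp,
    ⟨fun r => g (r ^ 2), fun _ => rfl⟩, hg.posDefFunction hg0, fun x => hg.1 _ (by positivity)⟩

theorem exists_norm_sq_eq (hd : 1 ≤ d) {y : ℝ} (hy : 0 ≤ y) :
    ∃ x : EuclideanSpace ℝ (Fin d), ‖x‖ ^ 2 = y :=
  ⟨EuclideanSpace.single ⟨0, hd⟩ (Real.sqrt y), by simp [Real.sq_sqrt hy]⟩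

/-- Splittings of a Gaussian inside the cone are proportional. -/
theorem eq_gaussian_of_add_mem_posPosDefCone (hd : 1 ≤ d) {u v : EuclideanSpace ℝ (Fin d) → ℝ}
    (hu : u ∈ posPosDefCone d) (hv : v ∈ posPosDefCone d) {c a : ℝ} (ha : 0 ≤ a)
    (h : ∀ x, u x + v x = c * Real.exp (-a * ‖x‖ ^ 2)) (x : EuclideanSpace ℝ (Fin d)) :
    u x = u 0 * Real.exp (-a * ‖x‖ ^ 2) := by
  obtain ⟨huc, ⟨u₀, hur⟩, hup, hu0⟩ := hu
  obtain ⟨hvc, ⟨v₀, hvr⟩, hvp, hv0⟩ := hv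
  rcases eq_or_lt_of_le ha with rfl | ha
  -- In the degenerate case `u` and `v` are both maximal at 0 while their sum is constant, so both
  -- are constant.
  · have h1 : u x ≤ u 0 := PosDefFunction.ofReal_le_zero hup (fun y => by simp [hur]) x
    have h2 : v x ≤ v 0 := PosDefFunction.ofReal_le_zero hvp (fun y => by simp [hvr]) x
    have h3 := h x
    have h4 := h 0
    simp at h3 h4 ⊢
    linarith
  -- This step length along a coordinate axis turns `exp (-a ‖x‖²)` into `exp (-π s²)`.
  · set r := Real.sqrt (Real.pi / a) with hr
    have hr0 : 0 < r := Real.sqrt_pos.2 (by positivity)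
    have hr2 : r ^ 2 = Real.pi / a := Real.sq_sqrt (by positivity)
    set e : EuclideanSpace ℝ (Fin d) := EuclideanSpace.single ⟨0, hd⟩ r with he
    have hen : ∀ s : ℝ, ‖s • e‖ = |s| * r := fun s => by
      simp [he, norm_smul, abs_of_pos hr0]
    have hsq : ∀ s : ℝ, -a * ‖s • e‖ ^ 2 = -Real.pi * s ^ 2 := fun s => by
      rw [hen, mul_pow, sq_abs, hr2]
      field_simp
    let L : ℝ →+ EuclideanSpace ℝ (Fin d) := (LinearMap.toSpanSingleton ℝ _ e).toAddMonoidHom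
    have hline := PosDefFunction.eq_gaussian_of_add (u := fun s : ℝ => u (s • e))
      (v := fun s : ℝ => v (s • e)) (c := c) (by fun_prop) (by fun_prop)
      (PosDefFunction.comp_hom (F := fun x => (u x : ℂ)) hup L)
      (PosDefFunction.comp_hom (F := fun x => (v x : ℂ)) hvp L)
      (fun s => hu0 _) (fun s => hv0 _) (fun s => by rw [h, hsq]) (‖x‖ / r)
    have hx : ‖(‖x‖ / r) • e‖ = ‖x‖ := by
      rw [hen, abs_of_nonneg (by positivity)]
      field_simp
    simp only [zero_smul] at hline
    rw [← hsq, hx, hur, hx, ← hur] at hline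
    exact hline

theorem isExtremalRayGenerator_gaussian (hd : 1 ≤ d) {f : EuclideanSpace ℝ (Fin d) → ℝ}
    (hf : f ∈ posPosDefCone d) {c a : ℝ} (hc : 0 ≤ c) (ha : 0 ≤ a)
    (h : ∀ x, f x = c * Real.exp (-a * ‖x‖ ^ 2)) :
    IsExtremalRayGenerator (posPosDefCone d) f := by
  refine ⟨hf, Set.ext fun u => ⟨?_, ?_⟩⟩
  · rintro ⟨hu, v, hv, huv⟩
    have hadd : ∀ x, u x + v x = c * Real.exp (-a * ‖x‖ ^ 2) := fun x => by
      rw [huv, ← h]; simp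
    have key := eq_gaussian_of_add_mem_posPosDefCone hd hu hv ha hadd
    have h0 := hadd 0
    simp at h0
    have hu0 := hu.2.2.2 0
    have hv0 := hv.2.2.2 0
    -- For `c = 0` the quotient is 0 by convention, which suits `u = 0`.
    refine ⟨u 0 / c, by positivity, div_le_one_of_le₀ (by linarith) hc, funext fun x => ?_⟩
    rcases eq_or_lt_of_le hc with rfl | hc
    · rw [key x, show u 0 = 0 by linarith]; simp
    · rw [key x, Pi.smul_apply, h, smul_eq_mul]
      field_simp
  · rintro ⟨t, ht0, ht1, rfl⟩
    refine ⟨smul_mem_posPosDefCone hf ht0, (1 - t) • f,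
      smul_mem_posPosDefCone hf (by linarith), ?_⟩
    rw [sub_smul, one_smul, sub_sub_cancel]

theorem IsExtremalRayGenerator.eq_gaussian (hd : 1 ≤ d) {g : ℝ → ℝ}
    (hg : IsCompletelyMonotonic g) (hg0 : ContinuousWithinAt g (Set.Ici 0) 0)
    (h : IsExtremalRayGenerator (posPosDefCone d) fun x => g (‖x‖ ^ 2)) :
    ∃ c a : ℝ, 0 ≤ c ∧ 0 ≤ a ∧ ∀ x, 0 ≤ x → g x = c * Real.exp (-a * x) := by
  refine hg.eq_exp_of_translates hg0 fun δ hδ => ?_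
  have hs0 := continuousWithinAt_comp_add (hg.continuousOn hg0) hδ.le
  have hmem : (fun x : EuclideanSpace ℝ (Fin d) => g (‖x‖ ^ 2 + δ)) ∈
      coneInterval (posPosDefCone d) fun x => g (‖x‖ ^ 2) :=
    ⟨(hg.comp_add hδ.le).mem_posPosDefCone hs0, _,
      (hg.sub_comp_add hg0 hδ.le).mem_posPosDefCone (hg0.sub hs0), by ext x; simp⟩
  rw [h.2] at hmem
  obtain ⟨t, -, -, ht⟩ := hmem
  refine ⟨t, fun y hy => ?_⟩
  obtain ⟨x, rfl⟩ := exists_norm_sq_eq hd hy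
  exact congrFun ht x

end Cone

theorem mainTheorem11 (d : ℕ) (hd : 1 ≤ d) (g : ℝ → ℝ) (hg : IsCompletelyMonotonic g)
    (hg0 : ContinuousWithinAt g (Set.Ici 0) 0)
    (f : EuclideanSpace ℝ (Fin d) → ℝ) (hf : ∀ x, f x = g (‖x‖ ^ 2)) :
    f ∈ posPosDefCone d ∧
    (IsExtremalRayGenerator (posPosDefCone d) f ↔
      ∃ c a : ℝ, 0 ≤ c ∧ 0 ≤ a ∧ ∀ x, f x = c * Real.exp (-a * ‖x‖ ^ 2)) ∧
    ((∃ x y, f x ≠ f y) →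
      (IsExtremalRayGenerator (posPosDefCone d) f ↔
        ∃ c a : ℝ, 0 < c ∧ 0 < a ∧ ∀ x, f x = c * Real.exp (-a * ‖x‖ ^ 2))) := by
  obtain rfl : f = fun x => g (‖x‖ ^ 2) := funext hf
  have hmem := hg.mem_posPosDefCone (d := d) hg0
  have hiff : IsExtremalRayGenerator (posPosDefCone d) (fun x => g (‖x‖ ^ 2)) ↔
      ∃ c a : ℝ, 0 ≤ c ∧ 0 ≤ a ∧ ∀ x : EuclideanSpace ℝ (Fin d),
        g (‖x‖ ^ 2) = c * Real.exp (-a * ‖x‖ ^ 2) := by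
    refine ⟨fun h => ?_, fun ⟨c, a, hc, ha, h⟩ => isExtremalRayGenerator_gaussian hd hmem hc ha h⟩
    obtain ⟨c, a, hc, ha, h⟩ := h.eq_gaussian hd hg hg0
    exact ⟨c, a, hc, ha, fun x => h _ (by positivity)⟩
  refine ⟨hmem, hiff, fun ⟨x, y, hxy⟩ => hiff.trans ⟨?_, ?_⟩⟩
  · rintro ⟨c, a, hc, ha, h⟩
    refine ⟨c, a, hc.lt_of_ne ?_, ha.lt_of_ne ?_, h⟩
    · rintro rfl
      exact hxy (by simp [h])
    · rintro rfl
      exact hxy (by simp [h])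
  · rintro ⟨c, a, hc, ha, h⟩
    exact ⟨c, a, hc.le, ha.le, h⟩
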